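/- Let $t\ge 0$ be an integer and let $\mathbf x=(x_n)_{n\ge0}$, $\mathbf y=(y_n)_{n\ge0}$, $\mathbf z=(z_n)_{n\ge0}$ be three families of independent indeterminates. Brenti's recursive matrix $A=[A_{n,k}]_{n,k\ge0}$, with entries in $\mathbb R[\mathbf x,\mathbf y,\mathbf z]$, is defined by $A_{0,0}=1$, by $A_{n,k}=0$ if $n<0$ or $k<0$, and by $$A_{n,k}=z_nA_{n-t,k-1}+y_nA_{n-1-t,k-1}+x_nA_{n-1,k}\qquad(n,k\ge0,\ n+k\ge1).$$ A matrix $[M_{i,j}]_{i,j\ge0}$ with entries in $\mathbb R[\mathbf x,\mathbf y,\mathbf z]$ is called $(\mathbf x,\mathbf y,\mathbf z)$-totally positive if all its (finite) minors are polynomials with nonnegative coefficients. The Toeplitz matrix of a sequence $(a_k)_{k\ge0}$ is $[a_{i-j}]_{i,j\ge0}$, where $a_k=0$ for $k<0$. **Corollary 6.2** (Brenti, Theorem 4.3). (i) The matrix $A$ is $(\mathbf x,\mathbf y,\mathbf z)$-totally positive. (ii) If $t\ge1$, then for every $n\ge0$ the Toeplitz matrix $[A_{n,i-j}]_{i,j\ge0}$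 of the $n$-th row $(A_{n,k})_{k\ge0}$ of $A$ is $(\mathbf x,\mathbf y,\mathbf z)$-totally positive. -/

import Mathlib

noncomputable section

namespace Brenti

/-- The indeterminates `x₀, x₁, …`, `y₀, y₁, …` and `z₀, z₁, …` (all distinct). -/
inductive Var : Type
  | x (n : ℕ) : Var
  | y (n : ℕ) : Var
  | z (n : ℕ) : Var

/-- The polynomial ring `ℝ[𝐱, 𝐲, 𝐳]`. -/
abbrev Poly : Type := MvPolynomial Var ℝ

/-- The entries `A_{n,k}`, for all integers `n` and `k`: they vanish when `n < 0` or `k < 0`,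
`A_{0,0} = 1`, and for all other `n, k ≥ 0` they are given by the recurrence
`A_{n,k} = z_n A_{n-t,k-1} + y_n A_{n-1-t,k-1} + x_n A_{n-1,k}`. -/
def entry (t : ℕ) (n k : ℤ) : Poly :=
  if n < 0 ∨ k < 0 then 0
  else if n = 0 ∧ k = 0 then 1
  else
    MvPolynomial.X (Var.z n.toNat) * entry t (n - t) (k - 1)
      + MvPolynomial.X (Var.y n.toNat) * entry t (n - 1 - t) (k - 1)
      + MvPolynomial.X (Var.x n.toNat) * entry t (n - 1) k
termination_by (n + k).toNat
decreasing_by all_goals omega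

/-- Brenti's recursive matrix `A = [A_{n,k}]_{n,k ≥ 0}` with parameter `t`. -/
def recMatrix (t : ℕ) : Matrix ℕ ℕ Poly :=
  Matrix.of fun n k => entry t n k

/-- The entries with a negative index vanish. -/
theorem entry_of_neg (t : ℕ) (n k : ℤ) (h : n < 0 ∨ k < 0) : entry t n k = 0 := by
  rw [entry, if_pos h]

/-- The initial value. -/
theorem entry_zero_zero (t : ℕ) : entry t 0 0 = 1 := by
  rw [entry]
  simp

/-- The recurrence, for `n, k ≥ 0` with `n + k ≥ 1`. -/
theorem entry_rec (t n k : ℕ) (h : 1 ≤ n + k) :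
    entry t n k =
      MvPolynomial.X (Var.z n) * entry t ((n : ℤ) - t) ((k : ℤ) - 1)
        + MvPolynomial.X (Var.y n) * entry t ((n : ℤ) - 1 - t) ((k : ℤ) - 1)
        + MvPolynomial.X (Var.x n) * entry t ((n : ℤ) - 1) k := by
  rw [entry, if_neg (by omega), if_neg (by omega), Int.toNat_natCast]

end Brenti

/-- All coefficients of the polynomial are nonnegative. -/
def NonnegCoeffs {σ : Type*} (p : MvPolynomial σ ℝ) : Prop :=
  ∀ m : σ →₀ ℕ, 0 ≤ p.coeff m

/-- An infinite matrix of polynomials is totally positive with respect to the indeterminates if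
every minor (the determinant of a square submatrix on finitely many rows and equally many columns,
each taken in increasing order) is a polynomial with nonnegative coefficients. -/
def TotallyPositive {σ : Type*} (M : Matrix ℕ ℕ (MvPolynomial σ ℝ)) : Prop :=
  ∀ (r : ℕ) (f g : Fin r → ℕ), StrictMono f → StrictMono g →
    NonnegCoeffs (M.submatrix f g).det

/-- The Toeplitz matrix `[a_{i-j}]_{i,j ≥ 0}` of a sequence `(a_k)_{k ≥ 0}`, where `a_k = 0` for
`k < 0`. -/
def toeplitz {R : Type*} [Zero R] (a : ℕ → R) : Matrix ℕ ℕ R :=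
  Matrix.of fun i j => if j ≤ i then a (i - j) else 0

end

noncomputable section

/-! Both parts rest on one instance of Cauchy–Binet (`TotallyPositive.of_row_combination`): if the
rows of `N` are nonnegative combinations of rows of a totally positive `M`, and the supports of
successive rows overlap in at most an endpoint, then every minor of `N` is a nonnegative combination
of minors of `M`.

For (i), let B = 1 ⊕ A. The recurrence says that row n of A, minus x_n times row n - 1, is y_n
B_{n-t} + z_n B_{n+1-t}. Column k of A thus depends on column k - 1 through B, so total positivity
follows by induction on the number of columns, with `TotallyPositive.of_row_recurrence` absorbing
the x-term.

For (ii), interleave the Toeplitz matrices of rows n, ..., n - t. Passing from n to n + 1 is again a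
combination of rows with small, ordered supports; this needs t ≥ 1. The desired Toeplitz matrix
consists of every (t + 1)-st row. -/

/-- The subsemiring of polynomials with nonnegative coefficients. -/
def nonnegCoeffsSubsemiring (σ : Type*) : Subsemiring (MvPolynomial σ ℝ) where
  carrier := {p | NonnegCoeffs p}
  zero_mem' m := by simp
  one_mem' m := by
    classical
    rw [MvPolynomial.coeff_one]
    split_ifs <;> norm_num
  add_mem' hp hq m := by
    rw [MvPolynomial.coeff_add]
    exact add_nonneg (hp m) (hq m)
  mul_mem' hp hq m := by
    classical
    rw [MvPolynomial.coeff_mul]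
    exact Finset.sum_nonneg fun _ _ => mul_nonneg (hp _) (hq _)

variable {σ : Type*}

theorem mem_nonnegCoeffsSubsemiring {p : MvPolynomial σ ℝ} :
    p ∈ nonnegCoeffsSubsemiring σ ↔ NonnegCoeffs p :=
  Iff.rfl

theorem NonnegCoeffs.zero : NonnegCoeffs (0 : MvPolynomial σ ℝ) :=
  (nonnegCoeffsSubsemiring σ).zero_mem

theorem NonnegCoeffs.one : NonnegCoeffs (1 : MvPolynomial σ ℝ) :=
  (nonnegCoeffsSubsemiring σ).one_mem

theorem NonnegCoeffs.X (v : σ) : NonnegCoeffs (MvPolynomial.X v : MvPolynomial σ ℝ) := by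
  classical
  intro m
  rw [MvPolynomial.coeff_X]
  split_ifs <;> norm_num

theorem NonnegCoeffs.ite {P : Prop} [Decidable P] {p q : MvPolynomial σ ℝ}
    (hp : NonnegCoeffs p) (hq : NonnegCoeffs q) : NonnegCoeffs (if P then p else q) := by
  split_ifs <;> assumption

/-! ### Operations that preserve total positivity -/

/-- Total positivity is inherited by a matrix whose rows are nonnegative combinations of rows of a
totally positive matrix, provided the supports of these combinations are weakly increasing. -/
theorem TotallyPositive.of_row_combination {M N : Matrix ℕ ℕ (MvPolynomial σ ℝ)}
    (hM : TotallyPositive M) {d : ℕ} (s : ℕ → Fin d → ℕ) (c : ℕ → Fin d → MvPolynomial σ ℝ)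
    (hc : ∀ i l, NonnegCoeffs (c i l)) (hs : ∀ i i', i < i' → ∀ l l', s i l ≤ s i' l')
    (hN : ∀ i j, N i j = ∑ l, c i l * M (s i l) j) : TotallyPositive N := by
  intro r f g hf hg
  have hrow : N.submatrix f g =
      fun a => ∑ l, c (f a) l • (fun b => M (s (f a) l) (g b)) := by
    funext a b
    simp [hN, Finset.sum_apply]
  have hdet : (N.submatrix f g).det =
      ∑ p : Fin r → Fin d, (∏ a, c (f a) (p a)) *
        (M.submatrix (fun a => s (f a) (p a)) g).det := by
    rw [hrow]
    change Matrix.detRowAlternating.toMultilinearMap _ = _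
    rw [MultilinearMap.map_sum]
    refine Finset.sum_congr rfl fun p _ => ?_
    rw [MultilinearMap.map_smul_univ, smul_eq_mul]
    rfl
  rw [hdet, ← mem_nonnegCoeffsSubsemiring]
  refine sum_mem fun p _ => mul_mem (prod_mem fun a _ => hc _ _) ?_
  have hmono : Monotone fun a => s (f a) (p a) := by
    intro a b hab
    rcases hab.eq_or_lt with rfl | h
    · exact le_rfl
    · exact hs _ _ (hf h) _ _
  -- A weakly increasing choice of rows is either strictly increasing, giving a minor of `M`, or
  -- repeats a row, giving zero.
  by_cases hinj : Function.Injective fun a => s (f a) (p a)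
  · exact hM r _ g (hmono.strictMono_of_injective hinj) hg
  · simp only [Function.Injective, not_forall] at hinj
    obtain ⟨a, b, hab, hne⟩ := hinj
    rw [Matrix.det_zero_of_row_eq hne]
    · exact zero_mem _
    · funext j
      exact congrArg (fun m => M m (g j)) hab

theorem TotallyPositive.submatrix {M : Matrix ℕ ℕ (MvPolynomial σ ℝ)} (hM : TotallyPositive M)
    {u v : ℕ → ℕ} (hu : StrictMono u) (hv : StrictMono v) : TotallyPositive (M.submatrix u v) :=
  fun r f g hf hg => hM r (u ∘ f) (v ∘ g) (hu.comp hf) (hv.comp hg)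

/-- The zero matrix is totally positive. -/
theorem totallyPositive_zero : TotallyPositive (0 : Matrix ℕ ℕ (MvPolynomial σ ℝ)) := by
  intro r f g _ _
  cases r with
  | zero =>
    rw [Matrix.det_isEmpty]
    exact .one
  | succ r =>
    rw [Matrix.det_eq_zero_of_row_eq_zero 0 fun _ => rfl]
    exact .zero

/-- The block diagonal sum of the `1 × 1` identity matrix and `M`. -/
def oneBlockSum {R : Type*} [Zero R] [One R] (M : Matrix ℕ ℕ R) : Matrix ℕ ℕ R
  | 0, 0 => 1
  | 0, _ + 1 => 0
  | _ + 1, 0 => 0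
  | i + 1, j + 1 => M i j

theorem oneBlockSum_eq_of_pos {R : Type*} [Zero R] [One R] (M : Matrix ℕ ℕ R) {i j : ℕ}
    (hi : 0 < i) (hj : 0 < j) : oneBlockSum M i j = M (i - 1) (j - 1) := by
  obtain ⟨i, rfl⟩ := Nat.exists_eq_succ_of_ne_zero hi.ne'
  obtain ⟨j, rfl⟩ := Nat.exists_eq_succ_of_ne_zero hj.ne'
  rfl

theorem oneBlockSum_zero_left {R : Type*} [Zero R] [One R] (M : Matrix ℕ ℕ R) {j : ℕ}
    (hj : 0 < j) : oneBlockSum M 0 j = 0 := by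
  obtain ⟨j, rfl⟩ := Nat.exists_eq_succ_of_ne_zero hj.ne'
  rfl

theorem oneBlockSum_zero_right {R : Type*} [Zero R] [One R] (M : Matrix ℕ ℕ R) {i : ℕ}
    (hi : 0 < i) : oneBlockSum M i 0 = 0 := by
  obtain ⟨i, rfl⟩ := Nat.exists_eq_succ_of_ne_zero hi.ne'
  rfl

/-- A minor using both row 0 and column 0 reduces to a minor of `M`; one using exactly one of them
has a zero row or column. -/
theorem TotallyPositive.oneBlockSum {M : Matrix ℕ ℕ (MvPolynomial σ ℝ)} (hM : TotallyPositive M) :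
    TotallyPositive (oneBlockSum M) := by
  have hpos : ∀ (r : ℕ) (f g : Fin r → ℕ), StrictMono f → StrictMono g →
      (∀ a, 0 < f a) → (∀ a, 0 < g a) → NonnegCoeffs ((_root_.oneBlockSum M).submatrix f g).det := by
    intro r f g hf hg hf0 hg0
    have h : (_root_.oneBlockSum M).submatrix f g =
        M.submatrix (fun a => f a - 1) (fun a => g a - 1) := by
      ext1 a b
      exact oneBlockSum_eq_of_pos M (hf0 a) (hg0 b)
    rw [h]
    refine hM r _ _ (fun a b hab => ?_) (fun a b hab => ?_)
    · have := hf hab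
      have := hf0 a
      omega
    · have := hg hab
      have := hg0 a
      omega
  intro r f g hf hg
  cases r with
  | zero =>
    rw [Matrix.det_isEmpty]
    exact .one
  | succ r =>
    have hfs : ∀ a : Fin r, 0 < f a.succ := fun a => (Nat.zero_le _).trans_lt (hf a.succ_pos)
    have hgs : ∀ a : Fin r, 0 < g a.succ := fun a => (Nat.zero_le _).trans_lt (hg a.succ_pos)
    rcases Nat.eq_zero_or_pos (f 0) with hf0 | hf0 <;> rcases Nat.eq_zero_or_pos (g 0) with hg0 | hg0
    · rw [Matrix.det_succ_row_zero, Fin.sum_univ_succ, Finset.sum_eq_zero]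
      · have h1 : _root_.oneBlockSum M 0 0 = 1 := rfl
        simp only [Fin.val_zero, pow_zero, one_mul, Matrix.submatrix_apply, hf0, hg0, h1, add_zero,
          Matrix.submatrix_submatrix]
        refine hpos r _ _ (hf.comp Fin.strictMono_succ)
          (hg.comp (Fin.strictMono_succAbove 0)) hfs fun a => ?_
        simpa using hgs a
      · intro j _
        rw [Matrix.submatrix_apply, hf0, oneBlockSum_zero_left M (hgs j), mul_zero, zero_mul]
    · rw [Matrix.det_eq_zero_of_row_eq_zero 0]
      · exact .zero
      · intro j
        rw [Matrix.submatrix_apply, hf0]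
        exact oneBlockSum_zero_left M (hg0.trans_le (hg.monotone (Fin.zero_le j)))
    · rw [Matrix.det_eq_zero_of_column_eq_zero 0]
      · exact .zero
      · intro i
        rw [Matrix.submatrix_apply, hg0]
        exact oneBlockSum_zero_right M (hf0.trans_le (hf.monotone (Fin.zero_le i)))
    · exact hpos _ f g hf hg (fun a => hf0.trans_le (hf.monotone (Fin.zero_le a)))
        (fun a => hg0.trans_le (hg.monotone (Fin.zero_le a)))

/-- The identity matrix is totally positive. -/
theorem totallyPositive_one : TotallyPositive (1 : Matrix ℕ ℕ (MvPolynomial σ ℝ)) := by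
  -- Each truncated identity is the block sum of 1 and the preceding one, and a finite minor sees
  -- only finitely many columns.
  have htrunc : ∀ K : ℕ, TotallyPositive
      (Matrix.of fun i j => if i = j ∧ j < K then (1 : MvPolynomial σ ℝ) else 0) := by
    intro K
    induction K with
    | zero =>
      convert totallyPositive_zero (σ := σ) using 1
      ext1 i j
      simp
    | succ K ih =>
      convert ih.oneBlockSum using 1
      ext1 i j
      rcases i with _ | i <;> rcases j with _ | j <;> simp [_root_.oneBlockSum]
  intro r f g hf hg
  obtain ⟨K, hK⟩ := (Set.finite_range g).bddAbove
  convert htrunc (K + 1) r f g hf hg using 2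
  ext1 a b
  have : g b < K + 1 := Nat.lt_succ_of_le (hK ⟨b, rfl⟩)
  simp only [Matrix.submatrix_apply, Matrix.one_apply, Matrix.of_apply, this, and_true]

/-- Solving a first order recurrence along the rows preserves total positivity. -/
theorem TotallyPositive.of_row_recurrence {H N : Matrix ℕ ℕ (MvPolynomial σ ℝ)}
    (hH : TotallyPositive H) (x : ℕ → MvPolynomial σ ℝ) (hx : ∀ n, NonnegCoeffs (x n))
    (h0 : ∀ j, N 0 j = H 0 j) (hrec : ∀ n j, N (n + 1) j = H (n + 1) j + x (n + 1) * N n j) :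
    TotallyPositive N := by
  -- Rows of `H` are replaced by rows of `N` one at a time; each step adds a multiple of row p,
  -- already final, to row p + 1.
  have hmix : ∀ p : ℕ, TotallyPositive (Matrix.of fun i j => if i ≤ p then N i j else H i j) := by
    intro p
    induction p with
    | zero =>
      convert hH using 1
      ext1 i j
      rcases i with _ | i <;> simp [h0]
    | succ p ih =>
      refine ih.of_row_combination (d := 2) (fun i => ![i - 1, i])
        (fun i => ![if i = p + 1 then x (p + 1) else 0, 1]) ?_ ?_ ?_
      · intro i l
        fin_cases l
        · exact .ite (hx _) .zero
        · exact .one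
      · intro i i' hi l l'
        fin_cases l <;> fin_cases l' <;> simp <;> omega
      · intro i j
        rcases lt_trichotomy i (p + 1) with hi | rfl | hi
        · simp [hi.le, Nat.lt_succ_iff.mp hi, hi.ne]
        · simp [hrec, add_comm]
        · simp [hi.not_ge, hi.ne', show ¬ i ≤ p by omega]
  intro r f g hf hg
  obtain ⟨K, hK⟩ := (Set.finite_range f).bddAbove
  convert hmix K r f g hf hg using 2
  ext1 a b
  simp [show f a ≤ K from hK ⟨a, rfl⟩]

/-! ### Total positivity of the recursive matrix -/

namespace Brenti

open MvPolynomial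

theorem entry_zero_left {t : ℕ} (ht : 1 ≤ t) {k : ℤ} (hk : k ≠ 0) : entry t 0 k = 0 := by
  rcases lt_or_gt_of_ne hk with hk | hk
  · exact entry_of_neg _ _ _ (Or.inr hk)
  · lift k to ℕ using hk.le
    have h := entry_rec t 0 k (by omega)
    rw [entry_of_neg t _ ((k : ℤ) - 1) (Or.inl (by omega)),
      entry_of_neg t _ ((k : ℤ) - 1) (Or.inl (by omega)),
      entry_of_neg t (((0 : ℕ) : ℤ) - 1) (k : ℤ) (Or.inl (by omega))] at h
    simpa using h

/-- The recursive matrix with all columns from the `K`-th on replaced by zero. -/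
def truncMatrix (t K : ℕ) : Matrix ℕ ℕ Poly :=
  Matrix.of fun n k => if k < K then recMatrix t n k else 0

/-- The coefficients that express `(I - X S) A` by the rows of `1 ⊕ A`, where `S` is the shift and
`X` is the diagonal matrix of the `x_n`. -/
def blockCoeff (t n : ℕ) : Fin 2 → Poly :=
  -- Where `n - t` or `n + 1 - t` truncates or equals 0, the coefficient vanishes, except that for n
  -- = 0 row 0 of the block sum supplies the initial value.
  ![if n = 0 then 1 else if t < n then X (Var.y n) else 0, if t ≤ n then X (Var.z n) else 0]

theorem truncMatrix_zero_left (t K k : ℕ) :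
    truncMatrix t (K + 1) 0 k =
      ∑ l, blockCoeff t 0 l * oneBlockSum (truncMatrix t K) (![0 - t, 0 + 1 - t] l) k := by
  rcases k with _ | k
  · rcases t with _ | t <;>
      simp [truncMatrix, recMatrix, blockCoeff, oneBlockSum, entry_zero_zero]
  · rcases t with _ | t
    · have h := entry_rec 0 0 (k + 1) (by omega)
      rw [entry_of_neg 0 (((0 : ℕ) : ℤ) - 1) _ (Or.inl (by omega)),
        entry_of_neg 0 (((0 : ℕ) : ℤ) - 1 - _) _ (Or.inl (by omega))] at h
      simp at h
      simp [truncMatrix, recMatrix, blockCoeff, oneBlockSum, h]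
    · have h := entry_zero_left (t := t + 1) (by omega) (k := (k : ℤ) + 1) (by omega)
      simp [truncMatrix, recMatrix, blockCoeff, oneBlockSum, h]

theorem truncMatrix_succ_left (t K n k : ℕ) :
    truncMatrix t (K + 1) (n + 1) k =
      ∑ l, blockCoeff t (n + 1) l *
          oneBlockSum (truncMatrix t K) (![n + 1 - t, n + 1 + 1 - t] l) k +
        X (Var.x (n + 1)) * truncMatrix t (K + 1) n k := by
  have h := entry_rec t (n + 1) k (by omega)
  rw [show ((n + 1 : ℕ) : ℤ) - 1 = n by push_cast; ring] at h
  simp only [Fin.sum_univ_two, blockCoeff, Matrix.cons_val_zero, Matrix.cons_val_one,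
    Nat.succ_ne_zero, if_false]
  rcases k with _ | k
  · rw [entry_of_neg t _ (((0 : ℕ) : ℤ) - 1) (Or.inr (by omega)),
      entry_of_neg t _ (((0 : ℕ) : ℤ) - 1) (Or.inr (by omega))] at h
    have h1 : (if t < n + 1 then X (Var.y (n + 1)) else 0) *
        oneBlockSum (truncMatrix t K) (n + 1 - t) 0 = 0 := by
      split_ifs with ht
      · rw [oneBlockSum_zero_right _ (by omega), mul_zero]
      · rw [zero_mul]
    have h2 : (if t ≤ n + 1 then X (Var.z (n + 1)) else 0) *
        oneBlockSum (truncMatrix t K) (n + 1 + 1 - t) 0 = 0 := by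
      split_ifs with ht
      · rw [oneBlockSum_zero_right _ (by omega), mul_zero]
      · rw [zero_mul]
    rw [h1, h2]
    simpa [truncMatrix, recMatrix] using h
  · rw [show ((k + 1 : ℕ) : ℤ) - 1 = k by push_cast; ring] at h
    by_cases hk : k < K
    · have h1 : (if t < n + 1 then X (Var.y (n + 1)) else 0) *
          oneBlockSum (truncMatrix t K) (n + 1 - t) (k + 1) =
          X (Var.y (n + 1)) * entry t ((n : ℤ) - t) k := by
        split_ifs with ht
        · rw [oneBlockSum_eq_of_pos _ (by omega) (by omega)]
          simp only [truncMatrix, recMatrix, Matrix.of_apply, Nat.add_sub_cancel, hk, if_true]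
          congr 3
          omega
        · rw [entry_of_neg t _ _ (Or.inl (by omega)), mul_zero, zero_mul]
      have h2 : (if t ≤ n + 1 then X (Var.z (n + 1)) else 0) *
          oneBlockSum (truncMatrix t K) (n + 1 + 1 - t) (k + 1) =
          X (Var.z (n + 1)) * entry t (((n + 1 : ℕ) : ℤ) - t) k := by
        split_ifs with ht
        · rw [oneBlockSum_eq_of_pos _ (by omega) (by omega)]
          simp only [truncMatrix, recMatrix, Matrix.of_apply, Nat.add_sub_cancel, hk, if_true]
          congr 3
          omega
        · rw [entry_of_neg t _ _ (Or.inl (by omega)), mul_zero, zero_mul]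
      rw [h1, h2]
      simp only [truncMatrix, recMatrix, Matrix.of_apply, Nat.succ_lt_succ hk, if_true]
      rw [h]
      ring
    · have h1 : ∀ i, oneBlockSum (truncMatrix t K) i (k + 1) = 0 := by
        intro i
        rcases i with _ | i <;> simp [oneBlockSum, truncMatrix, hk]
      simp only [h1, mul_zero]
      simp [truncMatrix, hk]

theorem totallyPositive_truncMatrix (t K : ℕ) : TotallyPositive (truncMatrix t K) := by
  induction K with
  | zero =>
    convert totallyPositive_zero (σ := Var) using 1
    ext1 n k
    simp [truncMatrix]
  | succ K ih =>
    have hH : TotallyPositive (Matrix.of fun n k => ∑ l, blockCoeff t n l *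
        oneBlockSum (truncMatrix t K) (![n - t, n + 1 - t] l) k) := by
      refine ih.oneBlockSum.of_row_combination (fun n => ![n - t, n + 1 - t]) (blockCoeff t)
        ?_ ?_ fun _ _ => rfl
      · intro n l
        fin_cases l
        · exact .ite .one (.ite (.X _) .zero)
        · exact .ite (.X _) .zero
      · intro n n' hn l l'
        fin_cases l <;> fin_cases l' <;> simp <;> omega
    exact hH.of_row_recurrence (fun n => X (Var.x n)) (fun _ => .X _)
      (truncMatrix_zero_left t K) (truncMatrix_succ_left t K)

theorem totallyPositive_recMatrix (t : ℕ) : TotallyPositive (recMatrix t) := by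
  intro r f g hf hg
  obtain ⟨K, hK⟩ := (Set.finite_range g).bddAbove
  convert totallyPositive_truncMatrix t (K + 1) r f g hf hg using 2
  ext1 a b
  have : g b < K + 1 := Nat.lt_succ_of_le (hK ⟨b, rfl⟩)
  simp only [Matrix.submatrix_apply, truncMatrix, Matrix.of_apply, this, if_true]

/-! ### Toeplitz matrices of the rows -/

/-- The Toeplitz matrices of the rows `n, n - 1, …, n - t` of the recursive matrix, with their rows
interleaved: the row with index `i (t + 1) + s` is the `i`-th row of the Toeplitz matrix of the
`(n - s)`-th row. -/
def stateMatrix (t n : ℕ) : Matrix ℕ ℕ Poly :=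
  Matrix.of fun q j =>
    entry t ((n : ℤ) - (q % (t + 1) : ℕ)) (((q / (t + 1) : ℕ) : ℤ) - j)

/-- Rows with index divisible by t + 1 are those of the identity; the others come from negative rows
of A and vanish. -/
theorem totallyPositive_stateMatrix_zero {t : ℕ} (ht : 1 ≤ t) :
    TotallyPositive (stateMatrix t 0) := by
  refine totallyPositive_one.of_row_combination (d := 1) (fun q _ => q / (t + 1))
    (fun q _ => if q % (t + 1) = 0 then 1 else 0) (fun _ _ => .ite .one .zero)
    (fun i i' hi _ _ => Nat.div_le_div_right hi.le) fun q j => ?_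
  simp only [stateMatrix, Matrix.of_apply, Finset.univ_unique, Finset.sum_singleton,
    Matrix.one_apply]
  by_cases hq : q % (t + 1) = 0
  · rw [hq]
    by_cases hj : q / (t + 1) = j
    · simp [hj, entry_zero_zero]
    · simp only [hj, if_true, if_false, mul_zero]
      simpa using entry_zero_left ht (k := ((q / (t + 1) : ℕ) : ℤ) - j) (by omega)
  · rw [if_neg hq, zero_mul]
    exact entry_of_neg _ _ _ (Or.inl (by omega))

/-- The coefficients that express the rows of `stateMatrix t n` by the rows of
`stateMatrix t (n - 1)`. -/
def stateCoeff (t n q : ℕ) : Fin 3 → Poly :=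
  if q % (t + 1) = 0 then
    -- At q = 0 the indices `q - 2` and `q - 1` truncate to 0, while the true terms have a negative
    -- column index, so they must be suppressed.
    ![if q = 0 then 0 else X (Var.z n), if q = 0 then 0 else X (Var.y n), X (Var.x n)]
  else ![0, 1, 0]

/-- The rows of `stateMatrix t (n - 1)` that contribute to the `q`-th row of `stateMatrix t n`. -/
def stateSupport (t q : ℕ) : Fin 3 → ℕ :=
  if q % (t + 1) = 0 then ![q - 2, q - 1, q] else ![q - 1, q - 1, q - 1]

theorem stateSupport_le (t q : ℕ) (l : Fin 3) : stateSupport t q l ≤ q := by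
  unfold stateSupport
  split_ifs <;> fin_cases l <;> simp

theorem le_stateSupport (t q : ℕ) (l : Fin 3) : q - 2 ≤ stateSupport t q l := by
  unfold stateSupport
  split_ifs <;> fin_cases l <;> simp <;> omega

/-- Only multiples of t + 1 reach back to q - 2 or forward to q, and for t ≥ 1 two of them are never
adjacent. -/
theorem stateSupport_mono {t : ℕ} (ht : 1 ≤ t) {q q' : ℕ} (h : q < q') (l l' : Fin 3) :
    stateSupport t q l ≤ stateSupport t q' l' := by
  by_cases h0 : q' % (t + 1) = 0
  · by_cases h1 : q % (t + 1) = 0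
    · have h2 : q + 2 ≤ q' := by
        have := Nat.add_mod q 1 (t + 1)
        by_contra hlt
        obtain rfl : q' = q + 1 := by omega
        rw [h0, h1, Nat.zero_add, Nat.mod_mod, Nat.mod_eq_of_lt (by omega)] at this
        omega
      have := stateSupport_le t q l
      have := le_stateSupport t q' l'
      omega
    · have h2 : stateSupport t q l = q - 1 := by
        unfold stateSupport
        rw [if_neg h1]
        fin_cases l <;> rfl
      have := le_stateSupport t q' l'
      omega
  · have h2 : stateSupport t q' l' = q' - 1 := by
      unfold stateSupport
      rw [if_neg h0]
      fin_cases l' <;> rfl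
    have := stateSupport_le t q l
    omega

/-- Write q = (t + 1)i + s. For s > 0 the row is a relabelling, as n + 1 - s = n - (s - 1). For s =
0 the recurrence applies: its z- and y-terms lie in block i - 1 at offsets t - 1 and t, that is, at
q - 2 and q - 1. -/
theorem stateMatrix_succ {t : ℕ} (ht : 1 ≤ t) (n q j : ℕ) :
    stateMatrix t (n + 1) q j =
      ∑ l, stateCoeff t (n + 1) q l * stateMatrix t n (stateSupport t q l) j := by
  have hdm : ∀ i s : ℕ, s < t + 1 → stateMatrix t n ((t + 1) * i + s) j =
      entry t ((n : ℤ) - s) ((i : ℤ) - j) := by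
    intro i s hs
    simp only [stateMatrix, Matrix.of_apply]
    rw [Nat.mul_add_mod, Nat.mod_eq_of_lt hs, Nat.mul_add_div (by omega), Nat.div_eq_of_lt hs,
      add_zero]
  have hdm' : ∀ i s : ℕ, s < t + 1 → stateMatrix t (n + 1) ((t + 1) * i + s) j =
      entry t (((n + 1 : ℕ) : ℤ) - s) ((i : ℤ) - j) := by
    intro i s hs
    simp only [stateMatrix, Matrix.of_apply]
    rw [Nat.mul_add_mod, Nat.mod_eq_of_lt hs, Nat.mul_add_div (by omega), Nat.div_eq_of_lt hs,
      add_zero]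
  obtain ⟨i, s, hs, rfl⟩ : ∃ i s, s < t + 1 ∧ q = (t + 1) * i + s :=
    ⟨q / (t + 1), q % (t + 1), Nat.mod_lt _ (by omega), (Nat.div_add_mod q (t + 1)).symm⟩
  have hmod : ((t + 1) * i + s) % (t + 1) = s := by
    rw [Nat.mul_add_mod, Nat.mod_eq_of_lt hs]
  rw [hdm' i s hs]
  simp only [stateCoeff, stateSupport, hmod, Fin.sum_univ_three]
  rcases s with _ | s
  · have hrec : entry t (((n + 1 : ℕ) : ℤ)) ((i : ℤ) - j) =
        X (Var.z (n + 1)) * entry t ((n : ℤ) - (t - 1 : ℕ)) ((i : ℤ) - 1 - j) +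
        X (Var.y (n + 1)) * entry t ((n : ℤ) - t) ((i : ℤ) - 1 - j) +
        X (Var.x (n + 1)) * entry t n ((i : ℤ) - j) := by
      rcases lt_or_ge i j with hij | hij
      · rw [entry_of_neg t _ _ (Or.inr (by omega)), entry_of_neg t _ _ (Or.inr (by omega)),
          entry_of_neg t _ _ (Or.inr (by omega)), entry_of_neg t _ _ (Or.inr (by omega))]
        simp
      · have h := entry_rec t (n + 1) (i - j) (by omega)
        rw [show ((n + 1 : ℕ) : ℤ) - 1 = n by push_cast; ring,
          show ((n + 1 : ℕ) : ℤ) - t = (n : ℤ) - (t - 1 : ℕ) by omega,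
          show ((i - j : ℕ) : ℤ) - 1 = (i : ℤ) - 1 - j by omega,
          show ((i - j : ℕ) : ℤ) = (i : ℤ) - j by omega] at h
        exact h
    have hx := hdm i 0 (by omega)
    simp only [Nat.cast_zero, sub_zero, add_zero] at hx ⊢
    rw [hrec]
    rcases i with _ | i
    · rw [entry_of_neg t _ (((0 : ℕ) : ℤ) - 1 - j) (Or.inr (by omega)),
        entry_of_neg t _ (((0 : ℕ) : ℤ) - 1 - j) (Or.inr (by omega))]
      simp only [mul_zero] at hx
      simp [hx]
    · have hz := hdm i (t - 1) (by omega)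
      have hy := hdm i t (by omega)
      rw [show (t + 1) * i + (t - 1) = (t + 1) * (i + 1) - 2 by rw [Nat.mul_succ]; omega] at hz
      rw [show (t + 1) * i + t = (t + 1) * (i + 1) - 1 by rw [Nat.mul_succ]; omega] at hy
      have hci : ((i + 1 : ℕ) : ℤ) - 1 - j = (i : ℤ) - j := by push_cast; ring
      rw [hci]
      have hne : (t + 1) * (i + 1) ≠ 0 := by positivity
      simp only [if_true, hne, if_false, Matrix.cons_val_zero, Matrix.cons_val_one,
        Matrix.cons_val]
      rw [hx, hy, hz]
  · have h := hdm i s (by omega)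
    simp only [Nat.succ_ne_zero, if_false, Matrix.cons_val_zero, Matrix.cons_val_one,
      Matrix.cons_val, zero_mul, one_mul, zero_add, add_zero]
    rw [show (t + 1) * i + (s + 1) - 1 = (t + 1) * i + s by omega, h]
    congr 1
    push_cast
    ring

theorem totallyPositive_stateMatrix {t : ℕ} (ht : 1 ≤ t) (n : ℕ) :
    TotallyPositive (stateMatrix t n) := by
  induction n with
  | zero => exact totallyPositive_stateMatrix_zero ht
  | succ n ih =>
    refine ih.of_row_combination (stateSupport t) (stateCoeff t (n + 1)) ?_
      (fun q q' h => stateSupport_mono ht h) (stateMatrix_succ ht n)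
    intro q l
    unfold stateCoeff
    split_ifs <;> fin_cases l <;> first | exact .zero | exact .one | exact .X _

theorem toeplitz_recMatrix_eq (t n : ℕ) :
    (toeplitz fun k : ℕ => recMatrix t n k) = (stateMatrix t n).submatrix ((t + 1) * ·) id := by
  ext1 i j
  simp only [toeplitz, recMatrix, stateMatrix, Matrix.of_apply, Matrix.submatrix_apply, id,
    Nat.mul_mod_right, Nat.mul_div_cancel_left i (Nat.succ_pos t), Nat.cast_zero, sub_zero]
  split_ifs with h
  · rw [Nat.cast_sub h]
  · exact (entry_of_neg _ _ _ (Or.inr (by omega))).symm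

end Brenti

end

theorem corollary6p2 (t : ℕ) :
    TotallyPositive (Brenti.recMatrix t) ∧
      (1 ≤ t → ∀ n : ℕ, TotallyPositive (toeplitz fun k : ℕ => Brenti.recMatrix t n k)) := by
  refine ⟨Brenti.totallyPositive_recMatrix t, fun ht n => ?_⟩
  rw [Brenti.toeplitz_recMatrix_eq]
  exact (Brenti.totallyPositive_stateMatrix ht n).submatrix
    (fun _ _ h => Nat.mul_lt_mul_of_pos_left h (Nat.succ_pos t)) strictMono_id
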